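/- All graphs are finite, simple and undirected. For a graph $G$ and a vertex $v$, the local complementation $G*v$ is the graph obtained from $G$ by toggling the adjacency of every pair of distinct neighbours of $v$; pivoting an edge $uv$ of $G$ yields the graph $G\wedge uv=G*u*v*u$. A graph $H$ is a pivot-minor of a graph $G$ if, up to isomorphism, $H$ can be obtained from $G$ by a (possibly empty) finite sequence of vertex deletions and pivotings of edges. For $X\subseteq V(G)$, the cut-rank $\operatorname{cutrk}_G(X)$ is the rank over $\mathrm{GF}(2)$ of the submatrix of the adjacency matrix of $G$ with rows $X$ and columns $V(G)\setminus X$. A rank-decomposition of $G$ is a pair $(T,L)$, where $T$ is a tree with at least two vertices in which every vertex has degree $1$ or $3$, and $L$ is a bijection from $V(G)$ to the set of leaves (degree-$1$ vertices) of $T$. Its width is the maximum, over all edges $e$ of $T$, of $\operatorname{cutrk}_G(L^{-1}(X_e))$, where $X_e$ is the set of leaves of $T$ in one of the two components of $T\setminus e$. The rank-width of $G$ is the minimum width of a rank-decomposition of $G$ if $|V(G)|\ge 2$, and $0$ if $|V(G)|\le 1$. **Theorem.** Let $G$ be a graph. Then $G$ is bipartite and has rank-width at most $1$ if and only if $G$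 is a pivot-minor of a tree. -/

import Mathlib

universe u

namespace SimpleGraph

section PivotMinors

variable {V : Type u}

/-- Local complementation `G * v`: adjacency is toggled between any two distinct neighbours
of `v`. -/
def localComplement (G : SimpleGraph V) (v : V) : SimpleGraph V where
  Adj x y := x ≠ y ∧ Xor (G.Adj x y) (G.Adj x v ∧ G.Adj y v)
  symm := ⟨fun x y h => by
    rw [G.adj_comm y x, and_comm (a := G.Adj y v)]
    exact ⟨h.1.symm, h.2⟩⟩
  loopless := ⟨fun _ h => h.1 rfl⟩

/-- The graph `G ∧ uv = G * u * v * u`; it is called pivoting when `uv` is an edge of `G`. -/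
def pivot (G : SimpleGraph V) (u v : V) : SimpleGraph V :=
  ((G.localComplement u).localComplement v).localComplement u

/-- `PivotDeleteReachable H G`: the graph `G` is obtained from `H` by a finite (possibly empty)
sequence of operations, each of which pivots an edge or deletes a vertex. -/
inductive PivotDeleteReachable {W : Type u} (H : SimpleGraph W) :
    ∀ {V : Type u}, SimpleGraph V → Prop
  | refl : PivotDeleteReachable H H
  | pivot {V : Type u} {G : SimpleGraph V} (h : PivotDeleteReachable H G) (u v : V)
      (huv : G.Adj u v) : PivotDeleteReachable H (G.pivot u v)
  | deleteVertex {V : Type u} {G : SimpleGraph V} (h : PivotDeleteReachable H G) (v : V) :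
      PivotDeleteReachable H (G.induce ({v}ᶜ : Set V))

/-- `G` is a pivot-minor of `H`; as usual for abstract graphs, `G` is identified with any graph
isomorphic to it. -/
def IsPivotMinor (G : SimpleGraph V) {W : Type u} (H : SimpleGraph W) : Prop :=
  ∃ (V' : Type u) (G' : SimpleGraph V'), PivotDeleteReachable H G' ∧ Nonempty (G ≃g G')

end PivotMinors

section RankWidth

open Classical in
/-- The cut-rank of `X`: the rank over the binary field of the submatrix of the adjacency matrix
with rows `X` and columns `V \ X`. -/
noncomputable def cutRank {V : Type u} [Fintype V] (G : SimpleGraph V) (X : Set V) : ℕ :=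
  ((G.adjMatrix (ZMod 2)).submatrix (fun a : X => (a : V))
    (fun b : (Xᶜ : Set V) => (b : V))).rank

open Classical in
/-- A leaf is a vertex of degree one. -/
def IsLeaf {N : Type u} [Fintype N] (T : SimpleGraph N) (x : N) : Prop :=
  T.degree x = 1

open Classical in
/-- A subcubic tree: a tree with at least two vertices all of whose inner (that is, non-leaf)
vertices have degree three. -/
structure IsSubcubicTree {N : Type u} [Fintype N] (T : SimpleGraph N) : Prop where
  isTree : T.IsTree
  two_le_card : 2 ≤ Fintype.card N
  degree_inner : ∀ x : N, ¬ T.IsLeaf x → T.degree x = 3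

/-- A rank-decomposition `(T, L)` of a graph on the vertex set `V`: a (finite) subcubic tree `T`
with a bijection `L` from `V` to the leaves of `T`. -/
structure RankDecomposition (V : Type u) where
  node : Type u
  [fintypeNode : Fintype node]
  tree : SimpleGraph node
  subcubic : tree.IsSubcubicTree
  L : V ≃ {x : node // tree.IsLeaf x}

attribute [instance] RankDecomposition.fintypeNode

/-- For an edge `e = xy` of the tree, the set of vertices of the graph sent by `L` to the
component of `T \ e` that contains `x`. -/
def RankDecomposition.side {V : Type u} (D : RankDecomposition V) (x y : D.node) : Set V :=
  {a | (D.tree.deleteEdges {s(x, y)}).Reachable x (D.L a)}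

/-- The width of a rank-decomposition of `G`: the maximum over the edges `xy` of its tree of the
cut-rank of a side of `xy`. Both sides occur here, as `xy` and as `yx`; they are complementary, so
they have the same cut-rank. -/
noncomputable def RankDecomposition.width {V : Type u} [Fintype V] (D : RankDecomposition V)
    (G : SimpleGraph V) : ℕ∞ :=
  ⨆ (x : D.node) (y : D.node) (_ : D.tree.Adj x y), (G.cutRank (D.side x y) : ℕ∞)

/-- The rank-width of `G`: the minimum width of its rank-decompositions, and `0` if `G` has at most
one vertex (when there is no rank-decomposition). -/
noncomputable def rankWidth {V : Type u} [Fintype V] (G : SimpleGraph V) : ℕ∞ :=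
  if Fintype.card V ≤ 1 then 0 else ⨅ D : RankDecomposition V, D.width G

end RankWidth

end SimpleGraph

namespace SimpleGraph

variable {V : Type u}

/-! ### Pivoting -/

/-! Both directions pass through `Elim`, the orderings that build a graph from isolated vertices,
pendant vertices and false twins.

A bipartite graph with a decomposition of width at most one has such an ordering
(`elim_of_decomposition`). Across a cut of rank at most one over GF(2) all nonzero rows are equal,
so of two vertices on one side, considered together with the other side only, one is isolated,
pendant or a false twin of the other. Applied from the leaves of the decomposition inwards, this
reduces each branch to one vertex. An ordering in turn yields a tree (`Elim.exists_tree`): each new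
vertex is paid for by attaching a path of three vertices, from which any of the three kinds of
vertex can be extracted after at most one further pivot.

Conversely, a tree has an ordering (`IsTree.elim`), hence a decomposition of width at most one
(`Elim.exists_decomposition`). Pivoting preserves bipartiteness and the bound on every cut, so the
same decomposition serves each pivot-equivalent graph. Deletions can be postponed, so a pivot-minor
is an induced subgraph of such a graph; it inherits an ordering from `elim_of_decomposition`, and
with it a decomposition of its own. -/

theorem localComplement_adj (G : SimpleGraph V) (v x y : V) :
    (G.localComplement v).Adj x y ↔ x ≠ y ∧ Xor (G.Adj x y) (G.Adj x v ∧ G.Adj y v) :=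
  Iff.rfl

/-- The nested equivalences encode a sum over GF(2): the entry `xy` plus the 2 × 2 minor with rows
`u`, `v` and columns `x`, `y`. -/
theorem pivot_adj_of_ne (G : SimpleGraph V) {u v x y : V} (huv : G.Adj u v)
    (hxu : x ≠ u) (hxv : x ≠ v) (hyu : y ≠ u) (hyv : y ≠ v) :
    (G.pivot u v).Adj x y ↔
      (G.Adj x y ↔ (G.Adj u x ∧ G.Adj v y ↔ G.Adj u y ∧ G.Adj v x)) := by
  have h1 := G.ne_of_adj huv
  by_cases hxy : x = y
  · subst hxy; simp
  simp only [pivot, localComplement_adj, Xor]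
  grind [G.irrefl, G.adj_comm]

theorem pivot_adj_left (G : SimpleGraph V) {u v y : V} (huv : G.Adj u v)
    (hyu : y ≠ u) (hyv : y ≠ v) : (G.pivot u v).Adj u y ↔ G.Adj v y := by
  have h1 := G.ne_of_adj huv
  simp only [pivot, localComplement_adj, Xor] at *
  grind [G.irrefl, G.adj_comm]

theorem pivot_adj_right (G : SimpleGraph V) {u v y : V} (huv : G.Adj u v)
    (hyu : y ≠ u) (hyv : y ≠ v) : (G.pivot u v).Adj v y ↔ G.Adj u y := by
  have h1 := G.ne_of_adj huv
  simp only [pivot, localComplement_adj, Xor] at *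
  grind [G.irrefl, G.adj_comm]

theorem pivot_adj_self (G : SimpleGraph V) {u v : V} (huv : G.Adj u v) :
    (G.pivot u v).Adj u v := by
  have h1 := G.ne_of_adj huv
  simp only [pivot, localComplement_adj, Xor] at *
  grind [G.irrefl, G.adj_comm]

/-- `H` arises from `G` by a sequence of pivotings of edges. -/
inductive PivotReachable (G : SimpleGraph V) : SimpleGraph V → Prop
  | refl : PivotReachable G G
  | pivot {H : SimpleGraph V} (h : PivotReachable G H) (u v : V) (huv : H.Adj u v) :
      PivotReachable G (H.pivot u v)

theorem IsBipartite.pivot {G : SimpleGraph V} (hG : G.IsBipartite) {u v : V} (huv : G.Adj u v) :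
    (G.pivot u v).IsBipartite := by
  classical
  obtain ⟨c⟩ := hG
  have hc : ∀ {x y}, G.Adj x y → c x ≠ c y := fun h => c.valid h
  have hfin : ∀ i j k : Fin 2, i ≠ j → j ≠ k → i = k := by decide
  -- Pivoting exchanges the outer neighbourhoods of `u` and `v`, so their colours are exchanged. Any
  -- other new edge joins the ends of a walk of length three through `uv`.
  refine ⟨Coloring.mk (fun x => c (Equiv.swap u v x)) ?_⟩
  have hne := G.ne_of_adj huv
  have h0 := hc huv
  have key : ∀ {x y}, (G.pivot u v).Adj x y → (x = u ∨ x = v ∨ (y ≠ u ∧ y ≠ v)) →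
      c (Equiv.swap u v x) ≠ c (Equiv.swap u v y) := by
    intro x y h hx
    have hxy := (G.pivot u v).ne_of_adj h
    by_cases hyu : y = u
    · subst hyu
      have : x = v := by grind
      subst this
      simpa using h0
    by_cases hyv : y = v
    · subst hyv
      have : x = u := by grind
      subst this
      simpa using h0.symm
    rw [Equiv.swap_apply_of_ne_of_ne hyu hyv]
    by_cases hxu : x = u
    · subst hxu
      rw [Equiv.swap_apply_left]
      exact hc ((G.pivot_adj_left huv hyu hyv).1 h)
    by_cases hxv : x = v
    · subst hxv
      rw [Equiv.swap_apply_right]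
      exact hc ((G.pivot_adj_right huv hyu hyv).1 h)
    rw [Equiv.swap_apply_of_ne_of_ne hxu hxv]
    rw [G.pivot_adj_of_ne huv hxu hxv hyu hyv] at h
    by_cases hadj : G.Adj x y
    · exact hc hadj
    have : (G.Adj u x ∧ G.Adj v y) ∨ (G.Adj u y ∧ G.Adj v x) := by tauto
    rcases this with ⟨h1, h2⟩ | ⟨h1, h2⟩ <;> have h1 := hc h1 <;> have h2 := hc h2 <;> grind
  intro x y h
  by_cases hx : x = u ∨ x = v ∨ (y ≠ u ∧ y ≠ v)
  · exact key h hx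
  · exact (key h.symm (by tauto)).symm

theorem PivotReachable.isBipartite {G H : SimpleGraph V} (h : G.PivotReachable H)
    (hG : G.IsBipartite) : H.IsBipartite := by
  induction h with
  | refl => exact hG
  | pivot _ u v huv ih => exact ih.pivot huv

/-! ### Cuts of rank at most one -/

/-- All `2 × 2` minors over the binary field of the bipartite adjacency matrix between
`S ∩ X` and `S \ X` vanish. -/
def CutLeOne (G : SimpleGraph V) (S X : Set V) : Prop :=
  ∀ ⦃a⦄, a ∈ S → a ∈ X → ∀ ⦃a'⦄, a' ∈ S → a' ∈ X → ∀ ⦃b⦄, b ∈ S → b ∉ X → ∀ ⦃b'⦄, b' ∈ S →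
    b' ∉ X → (G.Adj a b ∧ G.Adj a' b' ↔ G.Adj a b' ∧ G.Adj a' b)

/-- Local complementation acts on the cut matrix by adding the row of `v` (if `v ∈ X`) or its column
(if `v ∉ X`) to others, which keeps the rank. In terms of minors, those that involve `v` suffice. -/
theorem CutLeOne.localComplement {G : SimpleGraph V} {X : Set V} (h : G.CutLeOne Set.univ X)
    (v : V) : (G.localComplement v).CutLeOne Set.univ X := by
  intro a _ ha a' _ ha' b _ hb b' _ hb'
  have h1 := h trivial ha trivial ha' trivial hb trivial hb'
  have hab : a ≠ b := by rintro rfl; exact hb ha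
  have hab' : a ≠ b' := by rintro rfl; exact hb' ha
  have hb1 : a' ≠ b := by rintro rfl; exact hb ha'
  have hb2 : a' ≠ b' := by rintro rfl; exact hb' ha'
  simp only [localComplement_adj, ne_eq, hab, hab', hb1, hb2, not_false_eq_true, true_and, Xor]
  by_cases hv : v ∈ X
  · have h2 := h trivial ha trivial hv trivial hb trivial hb'
    have h3 := h trivial ha' trivial hv trivial hb trivial hb'
    rw [G.adj_comm v b, G.adj_comm v b'] at h2 h3
    grind
  · have h2 := h trivial ha trivial ha' trivial hb trivial hv
    have h3 := h trivial ha trivial ha' trivial hb' trivial hv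
    have h4 := G.adj_comm b v
    have h5 := G.adj_comm b' v
    grind

theorem PivotReachable.cutLeOne {G H : SimpleGraph V} (hGH : G.PivotReachable H) {X : Set V}
    (h : G.CutLeOne Set.univ X) : H.CutLeOne Set.univ X := by
  induction hGH with
  | refl => exact h
  | pivot _ u v _ ih => exact ((ih.localComplement u).localComplement v).localComplement u

theorem _root_.Matrix.rank_le_one_iff_minors {K m n : Type*} [Field K] [Fintype m] [Fintype n]
    (M : Matrix m n K) :
    M.rank ≤ 1 ↔ ∀ i i' j j', M i j * M i' j' = M i j' * M i' j := by
  constructor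
  · intro h i i' j j'
    rw [Matrix.rank_eq_finrank_span_row] at h
    obtain ⟨v, hv⟩ := finrank_le_one_iff.1 h
    have hrow : ∀ i, ∃ c : K, M i = c • (v : n → K) := by
      intro i
      obtain ⟨c, hc⟩ := hv ⟨M i, Submodule.subset_span ⟨i, rfl⟩⟩
      exact ⟨c, (congrArg Subtype.val hc).symm⟩
    obtain ⟨c, hc⟩ := hrow i
    obtain ⟨c', hc'⟩ := hrow i'
    simp only [hc, hc', Pi.smul_apply, smul_eq_mul]
    ring
  · intro h
    by_cases hM : ∃ i j, M i j ≠ 0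
    · obtain ⟨i, j, hij⟩ := hM
      -- A nonzero entry lets column `j` and the scaled row `i` generate the whole matrix as an
      -- outer product.
      have : M = Matrix.vecMulVec (fun k => M k j) (fun l => (M i j)⁻¹ * M i l) := by
        ext k l
        rw [Matrix.vecMulVec_apply]
        field_simp
        rw [h]
      rw [this]
      exact Matrix.rank_vecMulVec_le _ _
    · push Not at hM
      have : M = 0 := by ext i j; exact hM i j
      rw [this, Matrix.rank_zero]
      exact zero_le_one

theorem cutRank_le_one_iff [Fintype V] (G : SimpleGraph V) (X : Set V) :
    G.cutRank X ≤ 1 ↔ G.CutLeOne Set.univ X := by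
  classical
  unfold cutRank
  rw [Matrix.rank_le_one_iff_minors]
  simp only [Matrix.submatrix_apply, adjMatrix_apply, Subtype.forall]
  have key : ∀ p q r s : Prop, ∀ [Decidable p] [Decidable q] [Decidable r] [Decidable s],
      ((if p then (1 : ZMod 2) else 0) * (if q then 1 else 0) =
        (if r then 1 else 0) * (if s then 1 else 0)) ↔ (p ∧ q ↔ r ∧ s) := by
    intro p q r s _ _ _ _
    by_cases p <;> by_cases q <;> by_cases r <;> by_cases s <;> simp [*]
  constructor
  · intro h a _ ha a' _ ha' b _ hb b' _ hb'
    exact (key _ _ _ _).1 (h a ha a' ha' b hb b' hb')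
  · intro h a ha a' ha' b hb b' hb'
    exact (key _ _ _ _).2 (h trivial ha trivial ha' trivial hb trivial hb')

/-! ### Attaching a pendant vertex -/

/-- The graph obtained from `G` by attaching a new vertex `none` of degree one to `w`. -/
def addPendant (G : SimpleGraph V) (w : V) : SimpleGraph (Option V) where
  Adj
    | some x, some y => G.Adj x y
    | some x, none => x = w
    | none, some y => y = w
    | none, none => False
  symm := ⟨by
    rintro (_ | x) (_ | y) h
    exacts [h, h, h, G.symm.symm _ _ h]⟩
  loopless := ⟨by
    rintro (_ | x) h
    exacts [h, G.irrefl h]⟩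

section addPendant

variable (G : SimpleGraph V) (w : V)

@[simp] theorem addPendant_adj_some_some (x y : V) :
    (G.addPendant w).Adj (some x) (some y) ↔ G.Adj x y := Iff.rfl

@[simp] theorem addPendant_adj_some_none (x : V) :
    (G.addPendant w).Adj (some x) none ↔ x = w := Iff.rfl

@[simp] theorem addPendant_adj_none_some (x : V) :
    (G.addPendant w).Adj none (some x) ↔ x = w := Iff.rfl

/-- The map `Option.getD · w` contracts the pendant edge, and contracting an edge does not change
connectivity. -/
theorem addPendant_reachable_iff (x y : Option V) :
    (G.addPendant w).Reachable x y ↔ G.Reachable (x.getD w) (y.getD w) := by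
  constructor
  · intro h
    rw [reachable_iff_reflTransGen] at h
    induction h with
    | refl => exact Reachable.refl _
    | @tail b c _ hbc ih =>
      refine ih.trans ?_
      match b, c, hbc with
      | some b, some c, h => exact Adj.reachable h
      | some b, none, h => obtain rfl : b = w := h; exact Reachable.refl _
      | none, some c, h => obtain rfl : c = w := h; exact Reachable.refl _
  · intro h
    have hw : ∀ x : Option V, (G.addPendant w).Reachable (some (x.getD w)) x := by
      rintro (_ | x)
      · exact Adj.reachable (G := G.addPendant w) rfl
      · exact Reachable.refl _
    have hmap : ∀ x y : V, G.Reachable x y → (G.addPendant w).Reachable (some x) (some y) :=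
      fun x y h => h.map (⟨some, fun {_ _} h => h⟩ : G →g G.addPendant w)
    exact (hw x).symm.trans ((hmap _ _ h).trans (hw y))

theorem addPendant_deleteEdges_some (x y : V) :
    (G.addPendant w).deleteEdges {s(some x, some y)} =
      (G.deleteEdges {s(x, y)}).addPendant w := by
  ext (_ | a) (_ | b) <;> simp [deleteEdges_adj]

theorem reachable_addPendant_deleteEdges_none (x : Option V) :
    ((G.addPendant w).deleteEdges {s(none, some w)}).Reachable none x ↔ x = none := by
  constructor
  · intro h
    rw [reachable_iff_reflTransGen] at h
    induction h with
    | refl => rfl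
    | @tail b c _ hbc ih =>
      subst ih
      rw [deleteEdges_adj] at hbc
      match c, hbc with
      | some c, h => obtain rfl : c = w := h.1; exact absurd rfl h.2
      | none, h => rfl
  · rintro rfl
    exact Reachable.refl _

theorem reachable_addPendant_deleteEdges_some (hG : G.Connected) (x : Option V) :
    ((G.addPendant w).deleteEdges {s(some w, none)}).Reachable (some w) x ↔ x ≠ none := by
  constructor
  · rintro h rfl
    have := ((reachable_addPendant_deleteEdges_none G w (some w)).1
      (by rw [Sym2.eq_swap]; exact h.symm))
    simp at this
  · intro h
    obtain ⟨x, rfl⟩ := Option.ne_none_iff_exists'.1 h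
    exact (hG w x).map (⟨some, fun {a b} h => by simpa [deleteEdges_adj] using h⟩ :
      G →g (G.addPendant w).deleteEdges {s(some w, none)})

variable {G}

theorem IsTree.addPendant (hG : G.IsTree) (w : V) : (G.addPendant w).IsTree where
  connected :=
    { preconnected := fun x y => (addPendant_reachable_iff G w x y).2 (hG.connected _ _)
      nonempty := ⟨none⟩ }
  isAcyclic := by
    rw [isAcyclic_iff_forall_adj_isBridge]
    rintro (_ | x) (_ | y) h
    · exact absurd h (SimpleGraph.irrefl _)
    · obtain rfl : y = w := h
      rw [isBridge_iff, reachable_addPendant_deleteEdges_none]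
      simp
    · obtain rfl : x = w := h
      rw [isBridge_iff, reachable_addPendant_deleteEdges_some _ _ hG.connected]
      simp
    · rw [isBridge_iff, addPendant_deleteEdges_some, addPendant_reachable_iff]
      exact isAcyclic_iff_forall_adj_isBridge.1 hG.isAcyclic h

end addPendant

/-! ### The components of a tree minus an edge -/

section Branch

variable {T : SimpleGraph V}

/-- The vertices of the component of `T - xy` that contains `x`. -/
def branch (T : SimpleGraph V) (x y : V) : Set V :=
  {z | (T.deleteEdges {s(x, y)}).Reachable x z}

theorem self_mem_branch (x y : V) : x ∈ T.branch x y := Reachable.refl _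

theorem IsTree.notMem_branch (hT : T.IsTree) {x y : V} (h : T.Adj x y) : y ∉ T.branch x y :=
  isAcyclic_iff_forall_adj_isBridge.1 hT.isAcyclic h

theorem branch_induction {x y : V} {P : V → Prop} (h0 : P x)
    (h1 : ∀ a b, a ∈ T.branch x y → P a → T.Adj a b → s(a, b) ≠ s(x, y) → P b) :
    ∀ z ∈ T.branch x y, P z := by
  intro z hz
  have hz' : (T.deleteEdges {s(x, y)}).Reachable x z := hz
  rw [reachable_iff_reflTransGen] at hz'
  induction hz' with
  | refl => exact h0
  | @tail b c hb hbc ih =>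
    have hb' : b ∈ T.branch x y := (reachable_iff_reflTransGen _ _).2 hb
    rw [deleteEdges_adj] at hbc
    exact h1 b c hb' (ih hb') hbc.1 hbc.2

theorem mem_branch_of_adj {x y a b : V} (ha : a ∈ T.branch x y) (hab : T.Adj a b)
    (hne : s(a, b) ≠ s(x, y)) : b ∈ T.branch x y :=
  Reachable.trans ha (Adj.reachable (by rw [deleteEdges_adj]; exact ⟨hab, hne⟩))

theorem branch_subset_branch (hT : T.IsTree) {x y y' : V} (hy' : T.Adj x y') (hne : y' ≠ y) :
    T.branch y' x ⊆ T.branch x y := by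
  have hx : ∀ z ∈ T.branch y' x, z ≠ x := by
    rintro z hz rfl
    exact hT.notMem_branch hy'.symm hz
  refine branch_induction ?_ ?_
  · exact mem_branch_of_adj (self_mem_branch x y) hy' (by
      have := hy'.ne
      grind)
  · intro a b ha ih hab hs
    refine mem_branch_of_adj ih hab ?_
    have h1 := hx a ha
    have h2 := hx b (mem_branch_of_adj ha hab hs)
    simp [h1, h2]

theorem mem_branch_cases {x y : V} {z : V} (hz : z ∈ T.branch x y) :
    z = x ∨ ∃ y', T.Adj x y' ∧ y' ≠ y ∧ z ∈ T.branch y' x := by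
  refine branch_induction (P := fun z => z = x ∨ ∃ y', T.Adj x y' ∧ y' ≠ y ∧ z ∈ T.branch y' x)
    (Or.inl rfl) ?_ z hz
  intro a b _ ih hab hs
  by_cases hb : b = x
  · exact Or.inl hb
  rcases ih with rfl | ⟨y', hy', hne, ha⟩
  · exact Or.inr ⟨b, hab, by rintro rfl; exact hs rfl, self_mem_branch _ _⟩
  · by_cases hax : a = x
    · subst hax
      exact Or.inr ⟨b, hab, by rintro rfl; exact hs rfl, self_mem_branch _ _⟩
    · exact Or.inr ⟨y', hy', hne, mem_branch_of_adj ha hab (by simp [hb, hax])⟩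

theorem mem_branch_or_mem_branch (hT : T.Connected) (x y z : V) :
    z ∈ T.branch x y ∨ z ∈ T.branch y x := by
  have h := hT x z
  rw [reachable_iff_reflTransGen] at h
  induction h with
  | refl => exact Or.inl (self_mem_branch _ _)
  | @tail b c _ hbc ih =>
    by_cases hs : s(b, c) = s(x, y)
    · rw [Sym2.eq_iff] at hs
      rcases hs with ⟨_, rfl⟩ | ⟨_, rfl⟩
      · exact Or.inr (self_mem_branch _ _)
      · exact Or.inl (self_mem_branch _ _)
    · rcases ih with h | h
      · exact Or.inl (mem_branch_of_adj h hbc hs)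
      · exact Or.inr (mem_branch_of_adj h hbc (by rwa [Sym2.eq_swap (a := y)]))

end Branch

/-! ### Elimination orderings by isolated vertices, pendant vertices and false twins -/

/-- The induced subgraph of `G` on `S` can be built from at most one vertex by adding isolated
vertices, pendant vertices and false twins. -/
inductive Elim (G : SimpleGraph V) : Set V → Prop
  | base (S : Set V) (hS : S.Subsingleton) : Elim G S
  | step (S : Set V) (v w : V) (hv : v ∉ S) (hw : w ∈ S) (hS : Elim G S)
      (h : (∀ x ∈ S, ¬ G.Adj v x) ∨ (∀ x ∈ S, G.Adj v x ↔ x = w) ∨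
        (∀ x ∈ S, G.Adj v x ↔ G.Adj w x)) : Elim G (insert v S)

theorem IsBipartite.not_triangle {G : SimpleGraph V} (hG : G.IsBipartite) {a b c : V}
    (hab : G.Adj a b) (hbc : G.Adj b c) : ¬ G.Adj a c := by
  obtain ⟨C⟩ := hG
  intro hac
  have h1 := C.valid hab
  have h2 := C.valid hbc
  have h3 := C.valid hac
  revert h1 h2 h3
  generalize C a = i
  generalize C b = j
  generalize C c = k
  revert i j k
  decide

theorem Elim.insert_of_forall_not_adj {G : SimpleGraph V} {S : Set V} {a b : V} (hab : a ≠ b)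
    (ha : a ∉ S) (h : ∀ y ∈ S, ¬ G.Adj a y) (hE : G.Elim (insert b S)) :
    G.Elim (insert a (insert b S)) := by
  refine Elim.step _ a b (by simp [hab, ha]) (Set.mem_insert _ _) hE ?_
  by_cases hadj : G.Adj a b
  · refine Or.inr (Or.inl ?_)
    rintro x (rfl | hx)
    · simp [hadj]
    · have hxb : x ≠ b := by rintro rfl; exact h x hx hadj
      simp [h x hx, hxb]
  · refine Or.inl ?_
    rintro x (rfl | hx)
    · exact hadj
    · exact h x hx

/-- The rows of `a` and `b` over `S` are dependent over GF(2), so one vanishes or they agree. A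
vanishing row makes that vertex isolated or pendant at the other. Equal nonzero rows give a common
neighbour, so bipartiteness forbids the edge `ab` and the vertices are false twins. -/
theorem Elim.insert_insert {G : SimpleGraph V} (hG : G.IsBipartite) {S : Set V} {a b : V}
    (hab : a ≠ b) (ha : a ∉ S) (hb : b ∉ S)
    (hcut : ∀ y ∈ S, ∀ y' ∈ S, (G.Adj a y ∧ G.Adj b y' ↔ G.Adj a y' ∧ G.Adj b y))
    (hEa : G.Elim (insert a S)) (hEb : G.Elim (insert b S)) :
    G.Elim (insert a (insert b S)) := by
  by_cases h1 : ∃ y ∈ S, G.Adj a y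
  · by_cases h2 : ∃ y ∈ S, G.Adj b y
    · obtain ⟨y₀, hy₀, hay⟩ := h1
      obtain ⟨y₁, hy₁, hby⟩ := h2
      have hby₀ : G.Adj b y₀ := ((hcut y₀ hy₀ y₁ hy₁).1 ⟨hay, hby⟩).2
      have hnab : ¬ G.Adj a b := hG.not_triangle hay hby₀.symm
      refine Elim.step _ a b (by simp [hab, ha]) (Set.mem_insert _ _) hEb (Or.inr (Or.inr ?_))
      rintro x (rfl | hx)
      · simp [hnab]
      · have := hcut y₀ hy₀ x hx
        tauto
    · push Not at h2
      rw [Set.insert_comm]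
      exact Elim.insert_of_forall_not_adj hab.symm hb h2 hEa
  · push Not at h1
    exact Elim.insert_of_forall_not_adj hab ha h1 hEb

/-- If the cut around `A` has rank at most one, then elimination orderings of `G` restricted to
one vertex of `A` extend from two vertices of `A`. -/
theorem Elim.union_of_subsingleton {G : SimpleGraph V} (hG : G.IsBipartite) {A R : Set V}
    (hA : G.CutLeOne Set.univ A) (hR : Disjoint R A) (B₁ B₂ : Set V) (h₁ : B₁ ⊆ A) (h₂ : B₂ ⊆ A)
    (hB₁ : B₁.Subsingleton) (hB₂ : B₂.Subsingleton)
    (h : ∀ B ⊆ B₁ ∪ B₂, B.Subsingleton → G.Elim (R ∪ B)) : G.Elim (R ∪ B₁ ∪ B₂) := by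
  rcases hB₁.eq_empty_or_singleton with rfl | ⟨a, rfl⟩
  · rw [Set.union_empty]
    exact h B₂ Set.subset_union_right hB₂
  rcases hB₂.eq_empty_or_singleton with rfl | ⟨b, rfl⟩
  · rw [Set.union_empty]
    exact h {a} Set.subset_union_left hB₁
  have ha := h {a} Set.subset_union_left hB₁
  have hb := h {b} Set.subset_union_right hB₂
  by_cases hab : a = b
  · subst hab
    rwa [Set.union_assoc, Set.union_self]
  rw [Set.singleton_subset_iff] at h₁ h₂
  rw [Set.disjoint_left] at hR
  simp only [Set.union_singleton] at ha hb ⊢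
  rw [Set.insert_comm]
  refine Elim.insert_insert hG hab (fun h => hR h h₁) (fun h => hR h h₂) ?_ ha hb
  intro y hy y' hy'
  exact hA trivial h₁ trivial h₂ trivial (hR hy) trivial (hR hy')

theorem exists_two_of_ncard_eq_three {T : SimpleGraph V} {x y : V} (hxy : T.Adj x y)
    (h : (T.neighborSet x).ncard = 3) :
    ∃ y₁ y₂, T.Adj x y₁ ∧ y₁ ≠ y ∧ T.Adj x y₂ ∧ y₂ ≠ y ∧
      ∀ z, T.Adj x z → z = y ∨ z = y₁ ∨ z = y₂ := by
  obtain ⟨a, b, c, hab, hac, hbc, hs⟩ := Set.ncard_eq_three.1 h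
  have hz : ∀ z, T.Adj x z ↔ z = a ∨ z = b ∨ z = c := fun z => by
    rw [← mem_neighborSet, hs]; simp
  rcases (hz y).1 hxy with rfl | rfl | rfl
  · exact ⟨b, c, by simp [hz], hab.symm, by simp [hz], hac.symm, fun z => by rw [hz]; tauto⟩
  · exact ⟨a, c, by simp [hz], hab, by simp [hz], hbc.symm, fun z => by rw [hz]; tauto⟩
  · exact ⟨a, b, by simp [hz], hac, by simp [hz], hbc, fun z => by rw [hz]; tauto⟩

/-! ### Elimination orderings from decompositions of width at most one -/

section Decomposition

variable {N : Type*} [Finite N] {T : SimpleGraph N} {G : SimpleGraph V} {L : V → N}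

/-- A branch may be shrunk to at most one of its vertices: the two sub-branches at `x` are shrunk by
induction, and the cut around the whole branch then removes one of the two survivors. `S` has to
vary because the second sub-branch is treated after the first has shrunk. -/
theorem elim_of_branch (hT : T.IsTree)
    (hdeg : ∀ x, (T.neighborSet x).ncard = 1 ∨ (T.neighborSet x).ncard = 3)
    (hG : G.IsBipartite) (hL : Function.Injective L)
    (hleaf : ∀ a, (T.neighborSet (L a)).ncard = 1)
    (hcut : ∀ x y, T.Adj x y → G.CutLeOne Set.univ (L ⁻¹' T.branch x y)) :
    ∀ x y, T.Adj x y → ∀ S : Set V,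
      (∀ B ⊆ L ⁻¹' T.branch x y ∩ S, B.Subsingleton → G.Elim (S \ L ⁻¹' T.branch x y ∪ B)) →
      G.Elim S := by
  intro x y hxy
  induction hn : (T.branch x y).ncard using Nat.strong_induction_on generalizing x y with
  | _ n ih =>
    intro S hS
    by_cases h3 : (T.neighborSet x).ncard = 3
    · obtain ⟨y₁, y₂, hy₁, hne₁, hy₂, hne₂, hall⟩ := exists_two_of_ncard_eq_three hxy h3
      have hlt : ∀ y', T.Adj x y' → y' ≠ y → (T.branch y' x).ncard < n := by
        intro y' hy' hne
        rw [← hn]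
        refine Set.ncard_lt_ncard ⟨branch_subset_branch hT hy' hne, fun h => ?_⟩
          (Set.toFinite _)
        exact hT.notMem_branch hy'.symm (h (self_mem_branch x y))
      set A := L ⁻¹' T.branch x y with hA
      set A₁ := L ⁻¹' T.branch y₁ x with hA₁
      set A₂ := L ⁻¹' T.branch y₂ x with hA₂
      have hs₁ : A₁ ⊆ A := Set.preimage_mono (branch_subset_branch hT hy₁ hne₁)
      have hs₂ : A₂ ⊆ A := Set.preimage_mono (branch_subset_branch hT hy₂ hne₂)
      have hcov : A ⊆ A₁ ∪ A₂ := by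
        intro a ha
        rcases mem_branch_cases ha with h | ⟨y', hy', hne, h⟩
        · have := hleaf a
          rw [h] at this
          omega
        · rcases hall y' hy' with rfl | rfl | rfl
          · exact absurd rfl hne
          · exact Or.inl h
          · exact Or.inr h
      refine ih _ (hlt y₁ hy₁ hne₁) y₁ x hy₁.symm rfl S fun B₁ hB₁ hsub₁ => ?_
      refine ih _ (hlt y₂ hy₂ hne₂) y₂ x hy₂.symm rfl _ fun B₂ hB₂ hsub₂ => ?_
      -- Keeping `B₁ \ A₂` in place of `B₁` makes the disjointness of the two sub-branches
      -- unnecessary.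
      have heq : (S \ A₁ ∪ B₁) \ A₂ ∪ B₂ = S \ A ∪ (B₁ \ A₂) ∪ B₂ := by
        ext z
        have h1 := @hs₁ z
        have h2 := @hs₂ z
        have h3 := @hcov z
        simp only [Set.mem_union, Set.mem_sdiff] at h3 ⊢
        tauto
      have hBS : B₁ \ A₂ ∪ B₂ ⊆ A ∩ S := by
        rintro z (hz | hz)
        · exact ⟨hs₁ (hB₁ hz.1).1, (hB₁ hz.1).2⟩
        · refine ⟨hs₂ (hB₂ hz).1, ?_⟩
          rcases (hB₂ hz).2 with h | h
          · exact h.1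
          · exact (hB₁ h).2
      rw [heq]
      refine Elim.union_of_subsingleton hG (hcut x y hxy) Set.disjoint_sdiff_left _ _
        (fun z hz => (hBS (Or.inl hz)).1) (fun z hz => (hBS (Or.inr hz)).1)
        (hsub₁.anti Set.sdiff_subset) hsub₂ ?_
      exact fun B hB hBs => hS B (hB.trans hBS) hBs
    -- At a leaf the branch is `{x}`, so it holds at most one vertex of `G` and nothing has to be
    -- removed.
    · have h1 : (T.neighborSet x).ncard = 1 := (hdeg x).resolve_right h3
      obtain ⟨z, hz⟩ := Set.ncard_eq_one.1 h1
      have hx : ∀ a, L a ∈ T.branch x y → L a = x := by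
        intro a ha
        rcases mem_branch_cases ha with h | ⟨y', hy', hne, _⟩
        · exact h
        · have e1 : y' = z := by rw [← Set.mem_singleton_iff, ← hz]; exact hy'
          have e2 : y = z := by rw [← Set.mem_singleton_iff, ← hz]; exact hxy
          exact absurd (e1.trans e2.symm) hne
      have := hS (L ⁻¹' T.branch x y ∩ S) subset_rfl
        (fun a ha b hb => hL ((hx a ha.1).trans (hx b hb.1).symm))
      rwa [Set.inter_comm, Set.sdiff_union_inter] at this

theorem elim_of_decomposition [Nontrivial N] (hT : T.IsTree)
    (hdeg : ∀ x, (T.neighborSet x).ncard = 1 ∨ (T.neighborSet x).ncard = 3)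
    (hG : G.IsBipartite) (hL : Function.Injective L)
    (hleaf : ∀ a, (T.neighborSet (L a)).ncard = 1)
    (hcut : ∀ x y, T.Adj x y → G.CutLeOne Set.univ (L ⁻¹' T.branch x y)) (S : Set V) :
    G.Elim S := by
  obtain ⟨x⟩ := hT.connected.nonempty
  obtain ⟨y, hxy⟩ := hT.connected.preconnected.exists_adj_of_nontrivial x
  have key := elim_of_branch hT hdeg hG hL hleaf hcut
  refine key x y hxy S fun B₁ hB₁ hsub₁ => ?_
  refine key y x hxy.symm _ fun B₂ hB₂ hsub₂ => ?_
  have hempty : S \ L ⁻¹' T.branch x y ⊆ L ⁻¹' T.branch y x := fun z hz =>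
    (mem_branch_or_mem_branch hT.connected x y (L z)).resolve_left hz.2
  have heq : (S \ L ⁻¹' T.branch x y ∪ B₁) \ L ⁻¹' T.branch y x ∪ B₂ =
      ∅ ∪ (B₁ \ L ⁻¹' T.branch y x) ∪ B₂ := by
    ext z
    have := @hempty z
    simp only [Set.mem_union, Set.mem_sdiff, Set.mem_empty_iff_false] at this ⊢
    tauto
  rw [heq]
  -- Both ends of `xy` have been shrunk, so at most two vertices remain. The cut around `Set.univ`
  -- has no columns and its condition is vacuous.
  refine Elim.union_of_subsingleton hG (A := Set.univ) (fun _ _ _ _ _ _ _ _ h => absurd trivial h)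
    (Set.empty_disjoint _) _ _ (Set.subset_univ _) (Set.subset_univ _)
    (hsub₁.anti Set.sdiff_subset) hsub₂ ?_
  intro B _ hB
  rw [Set.empty_union]
  exact Elim.base _ hB

end Decomposition

/-! ### Trees -/

/-- Geodesics to `x` and `y`, prolonged to `v`, are both paths from `r` to `v`, and a tree has only
one. -/
theorem IsTree.eq_of_adj_of_dist_lt {T : SimpleGraph V} (hT : T.IsTree) {r v x y : V}
    (hx : T.Adj x v) (hy : T.Adj y v) (hdx : T.dist r v = T.dist r x + 1)
    (hdy : T.dist r v = T.dist r y + 1) : x = y := by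
  obtain ⟨p, hp⟩ := hT.connected.exists_walk_length_eq_dist r x
  obtain ⟨q, hq⟩ := hT.connected.exists_walk_length_eq_dist r y
  have h1 : (p.concat hx).IsPath := Walk.isPath_of_length_eq_dist _ (by simp [hp, hdx])
  have h2 : (q.concat hy).IsPath := Walk.isPath_of_length_eq_dist _ (by simp [hq, hdy])
  have := (hT.isAcyclic.subsingleton_path r v).elim ⟨_, h1⟩ ⟨_, h2⟩
  exact (Walk.concat_inj (congrArg Subtype.val this)).1

/-- A vertex of `S` farthest from a root `r` has at most its parent as a neighbour in `S`, so it can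
come last as a pendant or isolated vertex. -/
theorem IsTree.elim {T : SimpleGraph V} (hT : T.IsTree) {S : Set V} (hS : S.Finite) :
    T.Elim S := by
  obtain ⟨r⟩ := hT.connected.nonempty
  induction hn : S.ncard using Nat.strong_induction_on generalizing S with
  | _ n ih =>
    by_cases hsub : S.Subsingleton
    · exact Elim.base S hsub
    rw [Set.not_subsingleton_iff] at hsub
    obtain ⟨v, hv, hmax⟩ := hS.exists_maximalFor (T.dist r) S hsub.nonempty
    have hE : T.Elim (S \ {v}) :=
      ih _ (hn ▸ Set.ncard_sdiff_singleton_lt_of_mem hv hS) (hS.subset Set.sdiff_subset) rfl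
    have hdist : ∀ x ∈ S, T.Adj v x → T.dist r v = T.dist r x + 1 := by
      intro x hx hadj
      rcases hT.dist_eq_dist_add_one_of_adj r hadj with h | h
      · exact h
      · have := hmax hx (by omega)
        omega
    rw [← Set.insert_sdiff_self_of_mem hv]
    by_cases h : ∃ w ∈ S, T.Adj v w
    · obtain ⟨w, hw, hadj⟩ := h
      refine Elim.step _ v w (by simp) ⟨hw, hadj.ne'⟩ hE (Or.inr (Or.inl ?_))
      rintro x ⟨hx, -⟩
      refine ⟨fun hvx => ?_, fun h => h ▸ hadj⟩
      exact hT.eq_of_adj_of_dist_lt hvx.symm hadj.symm (hdist x hx hvx) (hdist w hw hadj)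
    · push Not at h
      obtain ⟨w, hw, hne⟩ := hsub.exists_ne v
      exact Elim.step _ v w (by simp) ⟨hw, hne⟩ hE (Or.inl fun x hx => h x hx.1)

/-! ### From elimination orderings to decompositions -/

theorem ncard_neighborSet_addPendant_none (T : SimpleGraph V) (w : V) :
    ((T.addPendant w).neighborSet none).ncard = 1 := by
  rw [Set.ncard_eq_one]
  refine ⟨some w, ?_⟩
  ext (_ | x) <;> simp

theorem ncard_neighborSet_addPendant_some (T : SimpleGraph V) {w x : V} (h : x ≠ w) :
    ((T.addPendant w).neighborSet (some x)).ncard = (T.neighborSet x).ncard := by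
  rw [← Set.ncard_image_of_injective _ (Option.some_injective V)]
  congr 1
  ext (_ | y) <;> simp [h]

theorem ncard_neighborSet_addPendant_self [Finite V] (T : SimpleGraph V) (w : V) :
    ((T.addPendant w).neighborSet (some w)).ncard = (T.neighborSet w).ncard + 1 := by
  rw [← Set.ncard_image_of_injective (T.neighborSet w) (Option.some_injective V),
    ← Set.ncard_insert_of_notMem (a := none) (by simp) (Set.toFinite _)]
  congr 1
  ext (_ | y) <;> simp

theorem mem_branch_addPendant_some (T : SimpleGraph V) (w x y : V) (z : Option V) :
    z ∈ (T.addPendant w).branch (some x) (some y) ↔ z.getD w ∈ T.branch x y := by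
  unfold branch
  rw [addPendant_deleteEdges_some, Set.mem_ofPred_eq, addPendant_reachable_iff]
  rfl

theorem mem_branch_addPendant_none (T : SimpleGraph V) (w : V) (z : Option V) :
    z ∈ (T.addPendant w).branch none (some w) ↔ z = none :=
  reachable_addPendant_deleteEdges_none T w z

theorem IsTree.mem_branch_addPendant_self {T : SimpleGraph V} (hT : T.IsTree) (w : V)
    (z : Option V) : z ∈ (T.addPendant w).branch (some w) none ↔ z ≠ none :=
  reachable_addPendant_deleteEdges_some T w hT.connected z

theorem cutLeOne_of_forall_mem_eq (G : SimpleGraph V) {S X : Set V} {p : V}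
    (h : ∀ a ∈ S, a ∈ X → a = p) : G.CutLeOne S X := by
  intro a ha hX a' ha' hX' b _ _ b' _ _
  rw [h a ha hX, h a' ha' hX', and_comm]

theorem cutLeOne_of_forall_notMem_eq (G : SimpleGraph V) {S X : Set V} {p : V}
    (h : ∀ a ∈ S, a ∉ X → a = p) : G.CutLeOne S X := by
  intro a _ _ a' _ _ b hb hX b' hb' hX'
  rw [h b hb hX, h b' hb' hX']

-- Sending `v` to `w` puts both on the same side. The enlarged cut matrix repeats the line of `w`
-- for a twin `v` and has a zero line at `v` otherwise, since a pendant edge `vw` does not cross.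
-- The weight `k` marks the lines that are not zeroed.
open Classical in
theorem CutLeOne.insert_vertex {G : SimpleGraph V} {S X : Set V} {v w : V} (hcut : G.CutLeOne S X)
    (hw : w ∈ S)
    (h : (∀ x ∈ S, ¬ G.Adj v x) ∨ (∀ x ∈ S, G.Adj v x ↔ x = w) ∨
        (∀ x ∈ S, G.Adj v x ↔ G.Adj w x)) :
    G.CutLeOne (insert v S) ((fun a => if a = v then w else a) ⁻¹' X) := by
  set r : V → V := fun a => if a = v then w else a with hr
  have hrS : ∀ a ∈ insert v S, r a ∈ S := by
    rintro a (rfl | ha)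
    · simpa [hr] using hw
    · by_cases hav : a = v
      · simpa [hr, hav] using hw
      · simpa [hr, hav] using ha
  have hrv : r v = w := if_pos rfl
  have hrne : ∀ a, a ≠ v → r a = a := fun a ha => if_neg ha
  obtain ⟨k, hk⟩ : ∃ k : V → Prop, ∀ a ∈ insert v S, r a ∈ X →
      ∀ b ∈ insert v S, r b ∉ X → (G.Adj a b ↔ k a ∧ k b ∧ G.Adj (r a) (r b)) := by
    have hmem : ∀ a ∈ insert v S, a ≠ v → a ∈ S := fun a ha hne => ha.resolve_left hne
    by_cases htwin : ∀ x ∈ S, G.Adj v x ↔ G.Adj w x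
    · refine ⟨fun _ => True, fun a ha hX b hb hY => ?_⟩
      by_cases hav : a = v <;> by_cases hbv : b = v
      · subst hav; subst hbv; exact absurd hX hY
      · subst hav
        rw [hrv, hrne b hbv, htwin b (hmem b hb hbv)]; simp
      · subst hbv
        rw [hrv, hrne a hav, G.adj_comm, htwin a (hmem a ha hav), G.adj_comm]; simp
      · rw [hrne a hav, hrne b hbv]; simp
    · have h' : ∀ x ∈ S, G.Adj v x → x = w := by
        rcases h with h | h | h
        · exact fun x hx hv => absurd hv (h x hx)
        · exact fun x hx => (h x hx).1
        · exact absurd h htwin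
      refine ⟨fun a => a ≠ v, fun a ha hX b hb hY => ?_⟩
      by_cases hav : a = v <;> by_cases hbv : b = v
      · subst hav; subst hbv; exact absurd hX hY
      · have : ¬ G.Adj a b := by
          intro hadj
          subst hav
          have := h' b (hmem b hb hbv) hadj
          rw [hrv] at hX
          rw [hrne b hbv, this] at hY
          exact hY hX
        exact iff_of_false this fun h => h.1 hav
      · have : ¬ G.Adj a b := by
          intro hadj
          subst hbv
          have := h' a (hmem a ha hav) hadj.symm
          rw [hrv] at hY
          rw [hrne a hav, this] at hX
          exact hY hX
        exact iff_of_false this fun h => h.2.1 hbv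
      · simp [hrne a hav, hrne b hbv, hav, hbv]
  intro a ha hX a' ha' hX' b hb hY b' hb' hY'
  have := hcut (hrS a ha) hX (hrS a' ha') hX' (hrS b hb) hY (hrS b' hb') hY'
  rw [hk a ha hX b hb hY, hk a' ha' hX' b' hb' hY', hk a ha hX b' hb' hY', hk a' ha' hX' b hb hY]
  tauto

-- The leaf of `w` sprouts two leaves, one for `w` and one for `v`. The new edges cut off single
-- vertices, and an old edge induces its old cut with `v` placed beside `w`, which is the case of
-- `CutLeOne.insert_vertex`.
open Classical in
theorem Elim.exists_decomposition {G : SimpleGraph V} {S : Set V} (hE : G.Elim S)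
    (hS : S.Nontrivial) :
    ∃ (N : Type u) (_ : Fintype N) (T : SimpleGraph N) (L : V → N), T.IsTree ∧
      (∀ x, (T.neighborSet x).ncard = 1 ∨ (T.neighborSet x).ncard = 3) ∧
      Set.BijOn L S {x | (T.neighborSet x).ncard = 1} ∧
      ∀ x y, T.Adj x y → G.CutLeOne S (L ⁻¹' T.branch x y) := by
  induction hE with
  | base S hsub => exact absurd hsub hS.not_subsingleton
  | step S v w hv hw _ h ih =>
    have hvw : v ≠ w := by rintro rfl; exact hv hw
    by_cases hS' : S.Nontrivial
    · obtain ⟨N, _, T, L, hT, hdeg, hL, hcut⟩ := ih hS'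
      set c := L w with hc
      have hcleaf : (T.neighborSet c).ncard = 1 := hL.mapsTo hw
      have hT₁ := hT.addPendant c
      have hd₁ : ∀ x, x ≠ some c → (((T.addPendant c).addPendant (some c)).neighborSet
          (some x)).ncard = ((T.addPendant c).neighborSet x).ncard := fun x hx =>
        ncard_neighborSet_addPendant_some _ hx
      have hd₂ : (((T.addPendant c).addPendant (some c)).neighborSet
          (some (some c))).ncard = 3 := by
        rw [ncard_neighborSet_addPendant_self, ncard_neighborSet_addPendant_self, hcleaf]
      have hd₃ : (((T.addPendant c).addPendant (some c)).neighborSet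
          (some none)).ncard = 1 := by
        rw [hd₁ _ (by simp), ncard_neighborSet_addPendant_none]
      have hd₄ : ∀ x, x ≠ c → (((T.addPendant c).addPendant (some c)).neighborSet
          (some (some x))).ncard = (T.neighborSet x).ncard := fun x hx => by
        rw [hd₁ _ (by simpa using hx), ncard_neighborSet_addPendant_some _ hx]
      set L' : V → Option (Option N) := fun x =>
        if x = v then none else if x = w then some none else some (some (L x)) with hL'
      have hLv : L' v = none := by simp [hL']
      have hLw : L' w = some none := by simp [hL', hvw.symm]
      have hLx : ∀ x, x ≠ v → x ≠ w → L' x = some (some (L x)) := by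
        intro x h1 h2; simp [hL', h1, h2]
      refine ⟨_, inferInstance, (T.addPendant c).addPendant (some c), L',
        hT₁.addPendant (some c), ?_, ⟨?_, ?_, ?_⟩, ?_⟩
      · rintro (_ | _ | x)
        · exact Or.inl (ncard_neighborSet_addPendant_none _ _)
        · exact Or.inl hd₃
        · by_cases hx : x = c
          · subst hx; exact Or.inr hd₂
          · rw [hd₄ x hx]; exact hdeg x
      · intro x hx
        by_cases h1 : x = v
        · rw [h1, hLv]; exact ncard_neighborSet_addPendant_none _ _
        by_cases h2 : x = w
        · rw [h2, hLw]; exact hd₃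
        have hxS : x ∈ S := hx.resolve_left h1
        rw [hLx x h1 h2, Set.mem_ofPred_eq, hd₄ _ (fun h => h2 (hL.injOn hxS hw h))]
        exact hL.mapsTo hxS
      · intro x hx y hy hxy
        have hxS : x ≠ v → x ∈ S := fun h => hx.resolve_left h
        have hyS : y ≠ v → y ∈ S := fun h => hy.resolve_left h
        by_cases x1 : x = v <;> by_cases y1 : y = v
        · rw [x1, y1]
        · by_cases y2 : y = w <;> simp [x1, hLv, y2, hLw, hLx y y1] at hxy
        · by_cases x2 : x = w <;> simp [y1, hLv, x2, hLw, hLx x x1] at hxy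
        · by_cases x2 : x = w <;> by_cases y2 : y = w
          · rw [x2, y2]
          · simp [x2, hLw, hLx y y1 y2] at hxy
          · simp [y2, hLw, hLx x x1 x2] at hxy
          · rw [hLx x x1 x2, hLx y y1 y2] at hxy
            exact hL.injOn (hxS x1) (hyS y1) (Option.some.inj (Option.some.inj hxy))
      · rintro (_ | _ | x) hx
        · exact ⟨v, Or.inl rfl, hLv⟩
        · exact ⟨w, Or.inr hw, hLw⟩
        · have hxc : x ≠ c := by
            rintro rfl
            rw [Set.mem_ofPred_eq, hd₂] at hx
            omega
          rw [Set.mem_ofPred_eq, hd₄ x hxc] at hx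
          obtain ⟨a, ha, rfl⟩ := hL.surjOn hx
          refine ⟨a, Or.inr ha, hLx a ?_ ?_⟩
          · rintro rfl; exact hv ha
          · rintro rfl; exact hxc rfl
      · have hnone : ∀ a, L' a = none ↔ a = v := by
          intro a
          by_cases h1 : a = v
          · simp [h1, hLv]
          by_cases h2 : a = w
          · simp [h2, hLw, hvw.symm]
          · simp [hLx a h1 h2, h1]
        have hsnone : ∀ a, (L' a).getD (some c) = none ↔ a = w := by
          intro a
          by_cases h1 : a = v
          · simp [h1, hLv, hvw]
          by_cases h2 : a = w
          · simp [h2, hLw]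
          · simp [hLx a h1 h2, h2]
        have hgetD : ∀ a, ((L' a).getD (some c)).getD c = L (if a = v then w else a) := by
          intro a
          by_cases h1 : a = v
          · simp [h1, hLv, hc]
          by_cases h2 : a = w
          · simp [h2, hLw, hvw.symm, hc]
          · simp [hLx a h1 h2, h1]
        rintro (_ | _ | x) (_ | _ | y) hxy
        · exact absurd hxy (SimpleGraph.irrefl _)
        · exact absurd hxy (by simp)
        · obtain rfl : y = c := Option.some.inj hxy
          refine cutLeOne_of_forall_mem_eq G (p := v) fun a _ ha => ?_
          rw [Set.mem_preimage, mem_branch_addPendant_none] at ha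
          exact (hnone a).1 ha
        · exact absurd hxy (by simp)
        · exact absurd hxy (SimpleGraph.irrefl _)
        · obtain rfl : y = c := hxy
          refine cutLeOne_of_forall_mem_eq G (p := w) fun a _ ha => ?_
          rw [Set.mem_preimage, mem_branch_addPendant_some, mem_branch_addPendant_none] at ha
          exact (hsnone a).1 ha
        · obtain rfl : x = c := Option.some.inj hxy
          refine cutLeOne_of_forall_notMem_eq G (p := v) fun a _ ha => ?_
          rw [Set.mem_preimage, hT₁.mem_branch_addPendant_self, not_not] at ha
          exact (hnone a).1 ha
        · obtain rfl : x = c := hxy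
          refine cutLeOne_of_forall_notMem_eq G (p := w) fun a _ ha => ?_
          rw [Set.mem_preimage, mem_branch_addPendant_some, hT.mem_branch_addPendant_self,
            not_not] at ha
          exact (hsnone a).1 ha
        · have hX : L' ⁻¹' ((T.addPendant c).addPendant (some c)).branch (some (some x))
              (some (some y)) = (fun a => if a = v then w else a) ⁻¹' (L ⁻¹' T.branch x y) := by
            ext a
            rw [Set.mem_preimage, mem_branch_addPendant_some, mem_branch_addPendant_some,
              Set.mem_preimage, Set.mem_preimage]
            rw [hgetD]
          rw [hX]
          exact (hcut x y hxy).insert_vertex hw h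
    -- Only `v` and `w` are present, and the decomposition tree is a single edge.
    · rw [Set.not_nontrivial_iff] at hS'
      obtain rfl : S = {w} := hS'.eq_singleton_of_mem hw
      have hT : (⊥ : SimpleGraph PUnit.{u + 1}).IsTree := IsTree.of_subsingleton
      have hd : ∀ x, (((⊥ : SimpleGraph PUnit.{u + 1}).addPendant PUnit.unit).neighborSet
          x).ncard = 1 := by
        rintro (_ | ⟨⟩)
        · exact ncard_neighborSet_addPendant_none _ _
        · rw [ncard_neighborSet_addPendant_self]
          simp [neighborSet]
      refine ⟨_, inferInstance, (⊥ : SimpleGraph PUnit.{u + 1}).addPendant PUnit.unit,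
        fun x => if x = v then none else some PUnit.unit, hT.addPendant _,
        fun x => Or.inl (hd x), ⟨fun x _ => hd _, ?_, ?_⟩, ?_⟩
      · rintro x (rfl | rfl) y (rfl | rfl) hxy <;> simp_all
      · rintro (_ | ⟨⟩) _
        · exact ⟨v, by simp, by simp⟩
        · exact ⟨w, by simp, by simp [hvw.symm]⟩
      · intro x y _
        rintro a (rfl | rfl) hX a' (rfl | rfl) hX' b (rfl | rfl) hY b' (rfl | rfl) hY' <;>
          first
            | exact absurd hX hY
            | exact absurd hX hY'
            | exact absurd hX' hY
            | exact absurd hX' hY'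
            | tauto

/-! ### From elimination orderings to pivot-minors of trees -/

/-- Pivoting affects only `u`, `v` and their neighbours, so the row of any other vertex is
unchanged. -/
theorem pivot_adj_of_not_adj (G : SimpleGraph V) {u v z : V} (huv : G.Adj u v)
    (hu : ¬ G.Adj z u) (hv : ¬ G.Adj z v) (x : V) : (G.pivot u v).Adj z x ↔ G.Adj z x := by
  have hzu : z ≠ u := by rintro rfl; exact hv huv
  have hzv : z ≠ v := by rintro rfl; exact hu huv.symm
  by_cases hxu : x = u
  · subst hxu
    rw [adj_comm, G.pivot_adj_left huv hzu hzv, G.adj_comm v]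
    tauto
  by_cases hxv : x = v
  · subst hxv
    rw [adj_comm, G.pivot_adj_right huv hzu hzv, G.adj_comm u]
    tauto
  rw [G.pivot_adj_of_ne huv hzu hzv hxu hxv, G.adj_comm u z, G.adj_comm v z]
  tauto

theorem pivot_adj_apply {W : Type*} {G : SimpleGraph V} {H : SimpleGraph W} {f : V → W}
    (hf : Function.Injective f) (h : ∀ x y, H.Adj (f x) (f y) ↔ G.Adj x y) (u v x y : V) :
    (H.pivot (f u) (f v)).Adj (f x) (f y) ↔ (G.pivot u v).Adj x y := by
  simp [pivot, localComplement_adj, h, hf.eq_iff]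

/-- Pivoting an edge at `w` turns a pendant vertex at `w` into a false twin of `w` and vice versa;
pivoting any other edge preserves both properties. -/
theorem pivot_pendant_or_twin {W : Type*} {G : SimpleGraph V} {H : SimpleGraph W} {f : V → W}
    (hf : Function.Injective f) (hfa : ∀ x y, H.Adj (f x) (f y) ↔ G.Adj x y) {a : W}
    (ha : ∀ x, f x ≠ a) {w u v : V} (huv : G.Adj u v)
    (h : (∀ x, H.Adj a (f x) ↔ x = w) ∨ (∀ x, H.Adj a (f x) ↔ G.Adj w x)) :
    (∀ x, (H.pivot (f u) (f v)).Adj a (f x) ↔ x = w) ∨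
      (∀ x, (H.pivot (f u) (f v)).Adj a (f x) ↔ (G.pivot u v).Adj w x) := by
  have huv' : H.Adj (f u) (f v) := (hfa u v).2 huv
  have hne : u ≠ v := huv.ne
  have hau : a ≠ f u := (ha u).symm
  have hav : a ≠ f v := (ha v).symm
  have e1 : (H.pivot (f u) (f v)).Adj a (f u) ↔ H.Adj a (f v) := by
    rw [adj_comm, H.pivot_adj_left huv' hau hav, adj_comm]
  have e2 : (H.pivot (f u) (f v)).Adj a (f v) ↔ H.Adj a (f u) := by
    rw [adj_comm, H.pivot_adj_right huv' hau hav, adj_comm]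
  have e3 : ∀ x, x ≠ u → x ≠ v → ((H.pivot (f u) (f v)).Adj a (f x) ↔
      (H.Adj a (f x) ↔ (H.Adj a (f u) ∧ G.Adj v x ↔ G.Adj u x ∧ H.Adj a (f v)))) := by
    intro x hxu hxv
    rw [H.pivot_adj_of_ne huv' hau hav (hf.ne hxu) (hf.ne hxv), hfa, hfa, H.adj_comm (f u) a,
      H.adj_comm (f v) a]
  have d0 := G.pivot_adj_self huv
  by_cases hwu : w = u
  · subst hwu
    rcases h with h | h
    · refine Or.inr fun x => ?_
      by_cases hxu : x = w
      · subst hxu; rw [e1, h]; simp [hne.symm]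
      by_cases hxv : x = v
      · subst hxv; rw [e2, h]; simp [d0]
      rw [e3 x hxu hxv, h, h, h, G.pivot_adj_left huv hxu hxv]
      simp [hxu, hne.symm]
    · refine Or.inl fun x => ?_
      by_cases hxu : x = w
      · subst hxu; rw [e1, h]; simp [huv]
      by_cases hxv : x = v
      · subst hxv; rw [e2, h]; simp [hne.symm]
      rw [e3 x hxu hxv, h, h, h]
      simp [hxu, huv]
  by_cases hwv : w = v
  · subst hwv
    rcases h with h | h
    · refine Or.inr fun x => ?_
      by_cases hxu : x = u
      · subst hxu; rw [e1, h]; simp [d0.symm]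
      by_cases hxv : x = w
      · subst hxv; rw [e2, h]; simp [hne]
      rw [e3 x hxu hxv, h, h, h, G.pivot_adj_right huv hxu hxv]
      simp [hxv, hne]
    · refine Or.inl fun x => ?_
      by_cases hxu : x = u
      · subst hxu; rw [e1, h]; simp [hne]
      by_cases hxv : x = w
      · subst hxv; rw [e2, h]; simp [huv.symm]
      rw [e3 x hxu hxv, h, h, h]
      simp [hxv, huv.symm]
  rcases h with h | h
  · refine Or.inl fun x => ?_
    rw [H.pivot_adj_of_not_adj huv' (by rw [h]; exact Ne.symm hwu) (by rw [h]; exact Ne.symm hwv),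
      h]
  · refine Or.inr fun x => ?_
    by_cases hxu : x = u
    · subst hxu
      rw [e1, h, (G.pivot x v).adj_comm, G.pivot_adj_left huv hwu hwv, G.adj_comm]
    by_cases hxv : x = v
    · subst hxv
      rw [e2, h, (G.pivot u x).adj_comm, G.pivot_adj_right huv hwu hwv, G.adj_comm]
    rw [e3 x hxu hxv, h, h, h, G.pivot_adj_of_ne huv hwu hwv hxu hxv, G.adj_comm u w,
      G.adj_comm v w]

/-- The state of a path `a, b, c` that was attached to the vertex `w` of a graph after pivotings
of edges have turned that graph into `G` and the extended graph into `H`. -/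
structure IsTail {W : Type*} (G : SimpleGraph V) (H : SimpleGraph W) (f : V → W) (a b c : W)
    (w : V) : Prop where
  injective : Function.Injective f
  apply_ne_a : ∀ x, f x ≠ a
  apply_ne_b : ∀ x, f x ≠ b
  apply_ne_c : ∀ x, f x ≠ c
  a_ne_c : a ≠ c
  adj_apply : ∀ x y, H.Adj (f x) (f y) ↔ G.Adj x y
  adj_a_b : H.Adj a b
  adj_b_c : H.Adj b c
  not_adj_b : ∀ x, ¬ H.Adj b (f x)
  not_adj_c : ∀ x, ¬ H.Adj c (f x)
  not_adj_c_a : ¬ H.Adj c a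
  isolated_or : (∀ x, ¬ G.Adj w x) ∨ (∀ x, H.Adj a (f x) ↔ x = w) ∨
    (∀ x, H.Adj a (f x) ↔ G.Adj w x)

theorem IsTail.pivot {W : Type*} {G : SimpleGraph V} {H : SimpleGraph W} {f : V → W} {a b c : W}
    {w u v : V} (h : IsTail G H f a b c w) (huv : G.Adj u v) :
    IsTail (G.pivot u v) (H.pivot (f u) (f v)) f a b c w := by
  have huv' : H.Adj (f u) (f v) := (h.adj_apply u v).2 huv
  have hb := H.pivot_adj_of_not_adj huv' (h.not_adj_b u) (h.not_adj_b v)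
  have hc := H.pivot_adj_of_not_adj huv' (h.not_adj_c u) (h.not_adj_c v)
  exact
    { injective := h.injective
      apply_ne_a := h.apply_ne_a
      apply_ne_b := h.apply_ne_b
      apply_ne_c := h.apply_ne_c
      a_ne_c := h.a_ne_c
      adj_apply := pivot_adj_apply h.injective h.adj_apply u v
      adj_a_b := ((hb a).2 h.adj_a_b.symm).symm
      adj_b_c := (hb c).2 h.adj_b_c
      not_adj_b := fun x => by rw [hb]; exact h.not_adj_b x
      not_adj_c := fun x => by rw [hc]; exact h.not_adj_c x
      not_adj_c_a := by rw [hc]; exact h.not_adj_c_a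
      isolated_or := by
        rcases h.isolated_or with h0 | h0
        · exact Or.inl fun x => by
            rw [G.pivot_adj_of_not_adj huv (h0 u) (h0 v)]; exact h0 x
        · exact Or.inr (pivot_pendant_or_twin h.injective h.adj_apply h.apply_ne_a huv h0) }

theorem PivotReachable.exists_isTail {W : Type*} {G G' : SimpleGraph V} {H : SimpleGraph W}
    {f : V → W} {a b c : W} {w : V} (hG : G.PivotReachable G') (h : IsTail G H f a b c w) :
    ∃ H', H.PivotReachable H' ∧ IsTail G' H' f a b c w := by
  induction hG with
  | refl => exact ⟨H, .refl, h⟩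
  | pivot _ u v huv ih =>
    obtain ⟨H', hH', ht⟩ := ih
    exact ⟨_, hH'.pivot (f u) (f v) ((ht.adj_apply u v).2 huv), ht.pivot huv⟩

theorem isTail_addPendant (T : SimpleGraph V) (w : V) :
    IsTail T (((T.addPendant w).addPendant none).addPendant none)
      (fun x => some (some (some x))) (some (some none)) (some none) none w where
  injective x y h := by simpa using h
  apply_ne_a x := by simp
  apply_ne_b x := by simp
  apply_ne_c x := by simp
  a_ne_c := by simp
  adj_apply x y := by simp
  adj_a_b := by simp
  adj_b_c := by simp
  not_adj_b x := by simp
  not_adj_c x := by simp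
  not_adj_c_a := by simp
  isolated_or := Or.inr (Or.inl fun x => by simp)

-- The vertices `p` and `q` take the roles of `v` and `w`. Since `w` may move to a new place `q`,
-- nothing is asked of the adjacencies of `f w`.
open Classical in
theorem exists_injOn_insert {U : Type*} {G : SimpleGraph V} {H : SimpleGraph U} {S : Set V}
    {v w : V} (hv : v ∉ S) (hw : w ∈ S) {f : V → U} {p q : U} (hpq : p ≠ q)
    (hf : Set.InjOn f S) (hp : ∀ x ∈ S, x ≠ w → f x ≠ p) (hq : ∀ x ∈ S, x ≠ w → f x ≠ q)
    (hff : ∀ x ∈ S, x ≠ w → ∀ y ∈ S, y ≠ w → (H.Adj (f x) (f y) ↔ G.Adj x y))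
    (hqf : ∀ x ∈ S, x ≠ w → (H.Adj q (f x) ↔ G.Adj w x))
    (hpf : ∀ x ∈ S, x ≠ w → (H.Adj p (f x) ↔ G.Adj v x)) (hadj : H.Adj p q ↔ G.Adj v w) :
    ∃ g : V → U, Set.InjOn g (insert v S) ∧
      ∀ x ∈ insert v S, ∀ y ∈ insert v S, H.Adj (g x) (g y) ↔ G.Adj x y := by
  have hvw : v ≠ w := by rintro rfl; exact hv hw
  set g : V → U := fun x => if x = v then p else if x = w then q else f x with hg
  have gv : g v = p := by simp [hg]
  have gw : g w = q := by simp [hg, hvw.symm]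
  have gx : ∀ x, x ≠ v → x ≠ w → g x = f x := fun x h1 h2 => by simp [hg, h1, h2]
  have cases : ∀ x ∈ insert v S, x = v ∨ x = w ∨ (x ∈ S ∧ x ≠ w ∧ g x = f x) := by
    rintro x (hx | hx)
    · exact Or.inl hx
    · by_cases h : x = w
      · exact Or.inr (Or.inl h)
      · exact Or.inr (Or.inr ⟨hx, h, gx x (by rintro rfl; exact hv hx) h⟩)
  refine ⟨g, ?_, ?_⟩
  · intro x hx y hy hxy
    rcases cases x hx with rfl | rfl | ⟨hxS, hxw, ex⟩ <;>
      rcases cases y hy with rfl | rfl | ⟨hyS, hyw, ey⟩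
    · rfl
    · exact absurd (gv ▸ gw ▸ hxy) hpq
    · rw [gv, ey] at hxy; exact absurd hxy.symm (hp y hyS hyw)
    · exact absurd (gv ▸ gw ▸ hxy) hpq.symm
    · rfl
    · rw [gw, ey] at hxy; exact absurd hxy.symm (hq y hyS hyw)
    · rw [gv, ex] at hxy; exact absurd hxy (hp x hxS hxw)
    · rw [gw, ex] at hxy; exact absurd hxy (hq x hxS hxw)
    · exact hf hxS hyS (ex ▸ ey ▸ hxy)
  · intro x hx y hy
    rcases cases x hx with rfl | rfl | ⟨hxS, hxw, ex⟩ <;>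
      rcases cases y hy with rfl | rfl | ⟨hyS, hyw, ey⟩
    · simp
    · rw [gv, gw, hadj]
    · rw [gv, ey, hpf y hyS hyw]
    · rw [gv, gw, adj_comm, hadj, adj_comm]
    · simp
    · rw [gw, ey, hqf y hyS hyw]
    · rw [gv, ex, adj_comm, hpf x hxS hxw, adj_comm]
    · rw [gw, ex, adj_comm, hqf x hxS hxw, adj_comm]
    · rw [ex, ey, hff x hxS hxw y hyS hyw]

/-- An isolated `v` is played by `c`. If `a` is already of the required kind, it plays `v`. If `a`
is a twin of `w` and a pendant is wanted, `a` plays `w` and `b` plays `v`. If `a` is pendant and a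
twin is wanted, pivoting the edge from `w` to `a` hands the neighbours of `w` to both `a` and `b`,
which become the twins. -/
theorem IsTail.exists_insert {W U : Type*} {G : SimpleGraph V} {H : SimpleGraph W}
    {H' : SimpleGraph U} {f : W → U} {a b c : U} {S : Set V} {v w : V} {φ : V → W}
    (h : IsTail H H' f a b c (φ w)) (hv : v ∉ S) (hw : w ∈ S) (hφ : Set.InjOn φ S)
    (hadj : ∀ x ∈ S, ∀ y ∈ S, H.Adj (φ x) (φ y) ↔ G.Adj x y)
    (hE : (∀ x ∈ S, ¬ G.Adj v x) ∨ (∀ x ∈ S, G.Adj v x ↔ x = w) ∨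
        (∀ x ∈ S, G.Adj v x ↔ G.Adj w x)) :
    ∃ H'', H'.PivotReachable H'' ∧ ∃ g : V → U, Set.InjOn g (insert v S) ∧
      ∀ x ∈ insert v S, ∀ y ∈ insert v S, H''.Adj (g x) (g y) ↔ G.Adj x y := by
  have hinj : Set.InjOn (f ∘ φ) S := h.injective.injOn.comp hφ (Set.mapsTo_univ _ _)
  have hne : ∀ x ∈ S, x ≠ w → φ x ≠ φ w := fun x hx hxw e => hxw (hφ hx hw e)
  have hff : ∀ x ∈ S, x ≠ w → ∀ y ∈ S, y ≠ w →
      (H'.Adj ((f ∘ φ) x) ((f ∘ φ) y) ↔ G.Adj x y) := fun x hx _ y hy _ => by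
    rw [Function.comp_apply, Function.comp_apply, h.adj_apply, hadj x hx y hy]
  have hwf : ∀ x ∈ S, x ≠ w → (H'.Adj (f (φ w)) ((f ∘ φ) x) ↔ G.Adj w x) := fun x hx _ => by
    rw [Function.comp_apply, h.adj_apply, hadj w hw x hx]
  have hwne : ∀ x ∈ S, x ≠ w → (f ∘ φ) x ≠ f (φ w) := fun x hx hxw e =>
    hne x hx hxw (h.injective e)
  have nea : ∀ x ∈ S, x ≠ w → (f ∘ φ) x ≠ a := fun x _ _ => h.apply_ne_a _
  have neb : ∀ x ∈ S, x ≠ w → (f ∘ φ) x ≠ b := fun x _ _ => h.apply_ne_b _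
  have nec : ∀ x ∈ S, x ≠ w → (f ∘ φ) x ≠ c := fun x _ _ => h.apply_ne_c _
  have hisolated : (∀ x ∈ S, ¬ G.Adj v x) → _ := fun hG =>
    exists_injOn_insert (p := c) (q := f (φ w)) (G := G) (H := H') hv hw
      (h.apply_ne_c _).symm hinj nec hwne hff hwf
      (fun x hx _ => iff_of_false (h.not_adj_c _) (hG x hx))
      (iff_of_false (h.not_adj_c _) (hG w hw))
  have hGw : (∀ x, ¬ H.Adj (φ w) x) → ∀ x ∈ S, ¬ G.Adj w x := fun h0 x hx => by
    rw [← hadj w hw x hx]; exact h0 _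
  rcases hE with hG | hG | hG
  · exact ⟨H', .refl, hisolated hG⟩
  · have hGx : ∀ x ∈ S, x ≠ w → ¬ G.Adj v x := fun x hx hxw => by rw [hG x hx]; exact hxw
    have hGvw : G.Adj v w := (hG w hw).2 rfl
    rcases h.isolated_or with h0 | h0 | h0
    · exact ⟨H', .refl, exists_injOn_insert (p := c) (q := b) hv hw h.adj_b_c.ne' hinj nec neb hff
        (fun x hx _ => iff_of_false (h.not_adj_b _) (hGw h0 x hx))
        (fun x hx hxw => iff_of_false (h.not_adj_c _) (hGx x hx hxw))
        (iff_of_true h.adj_b_c.symm hGvw)⟩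
    · exact ⟨H', .refl, exists_injOn_insert (p := a) (q := f (φ w)) hv hw (h.apply_ne_a _).symm hinj
        nea hwne hff hwf
        (fun x hx hxw => iff_of_false (by rw [Function.comp_apply, h0]; exact hne x hx hxw)
          (hGx x hx hxw))
        (iff_of_true ((h0 _).2 rfl) hGvw)⟩
    · exact ⟨H', .refl, exists_injOn_insert (p := b) (q := a) hv hw h.adj_a_b.ne' hinj neb nea hff
        (fun x hx _ => by rw [Function.comp_apply, h0, hadj w hw x hx])
        (fun x hx hxw => iff_of_false (h.not_adj_b _) (hGx x hx hxw))
        (iff_of_true h.adj_a_b.symm hGvw)⟩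
  · rcases h.isolated_or with h0 | h0 | h0
    · exact ⟨H', .refl, hisolated fun x hx => by rw [hG x hx]; exact hGw h0 x hx⟩
    · have hwa : H'.Adj (f (φ w)) a := ((h0 _).2 rfl).symm
      have hax : ∀ x ∈ S, x ≠ w → ¬ H'.Adj a (f (φ x)) := fun x hx hxw => by
        rw [h0]; exact hne x hx hxw
      have hbw : ¬ H'.Adj (f (φ w)) b := fun hb => h.not_adj_b _ hb.symm
      refine ⟨H'.pivot (f (φ w)) a, .pivot .refl _ _ hwa,
        exists_injOn_insert (p := b) (q := a) hv hw h.adj_a_b.ne' hinj neb nea ?_ ?_ ?_ ?_⟩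
      · intro x hx hxw y hy hyw
        rw [H'.pivot_adj_of_ne hwa (hwne x hx hxw) (nea x hx hxw) (hwne y hy hyw) (nea y hy hyw),
          hff x hx hxw y hy hyw]
        have h1 := hax x hx hxw
        have h2 := hax y hy hyw
        simp [h1, h2]
      · intro x hx hxw
        rw [H'.pivot_adj_right hwa (hwne x hx hxw) (nea x hx hxw), hwf x hx hxw]
      · intro x hx hxw
        rw [H'.pivot_adj_of_ne hwa (h.apply_ne_b _).symm h.adj_a_b.ne' (hwne x hx hxw)
          (nea x hx hxw), hG x hx, ← hwf x hx hxw]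
        have h1 := hax x hx hxw
        have h2 := h.not_adj_b (φ x)
        simp [h1, h2, hbw, h.adj_a_b]
      · rw [adj_comm, H'.pivot_adj_right hwa (h.apply_ne_b _).symm h.adj_a_b.ne', hG w hw]
        simp [hbw]
    · exact ⟨H', .refl, exists_injOn_insert (p := a) (q := f (φ w)) hv hw (h.apply_ne_a _).symm hinj
        nea hwne hff hwf
        (fun x hx _ => by rw [Function.comp_apply, h0, hadj w hw x hx, hG x hx])
        (by rw [h0, hG w hw]; simp)⟩

theorem Elim.exists_tree {G : SimpleGraph V} {S : Set V} (hE : G.Elim S) :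
    ∃ (W : Type u) (_ : Fintype W) (T H : SimpleGraph W) (φ : V → W), T.IsTree ∧
      T.PivotReachable H ∧ Set.InjOn φ S ∧
      ∀ x ∈ S, ∀ y ∈ S, H.Adj (φ x) (φ y) ↔ G.Adj x y := by
  induction hE with
  | base S hS =>
    refine ⟨PUnit.{u + 1}, inferInstance, ⊥, ⊥, fun _ => PUnit.unit, IsTree.of_subsingleton, .refl,
      hS.injOn _, fun x hx y hy => ?_⟩
    rw [hS hx hy]
    simp
  | step S v w hv hw _ h ih =>
    obtain ⟨W, _, T, H, φ, hT, hH, hφ, hadj⟩ := ih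
    -- The path is attached to the tree `T`, so that the result is a tree; the pivots leading from
    -- `T` to `H` are then replayed in the larger graph.
    obtain ⟨H', hH', ht⟩ := hH.exists_isTail (isTail_addPendant T (φ w))
    obtain ⟨H'', hH'', g, hg, hga⟩ := ht.exists_insert hv hw hφ hadj h
    have htrans : (((T.addPendant (φ w)).addPendant none).addPendant none).PivotReachable H'' := by
      clear hga ht
      induction hH'' with
      | refl => exact hH'
      | pivot _ u v huv ih => exact ih.pivot u v huv
    exact ⟨_, inferInstance, _, H'', g, ((hT.addPendant _).addPendant _).addPendant _, htrans, hg,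
      hga⟩

/-! ### Pivot-minors as induced subgraphs of pivot-equivalent graphs -/

/-- The effect of a pivot on a pair depends only on the pair and the pivoted edge, so pivoting
commutes with passing to induced subgraphs and all deletions can come last. -/
theorem PivotDeleteReachable.exists_embedding {W V : Type u} {H : SimpleGraph W}
    {G : SimpleGraph V} (h : PivotDeleteReachable H G) :
    ∃ H', H.PivotReachable H' ∧ Nonempty (G ↪g H') := by
  induction h with
  | refl => exact ⟨H, .refl, ⟨Embedding.refl⟩⟩
  | pivot _ u v huv ih =>
    obtain ⟨H', hH', ⟨e⟩⟩ := ih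
    exact ⟨H'.pivot (e u) (e v), hH'.pivot _ _ (e.map_adj_iff.2 huv),
      ⟨⟨e.toEmbedding, pivot_adj_apply e.injective (fun x y => e.map_adj_iff) u v _ _⟩⟩⟩
  | deleteVertex _ v ih =>
    obtain ⟨H', hH', ⟨e⟩⟩ := ih
    exact ⟨H', hH', ⟨e.comp (Embedding.induce _)⟩⟩

theorem PivotReachable.pivotDeleteReachable {V : Type u} {G H : SimpleGraph V}
    (h : G.PivotReachable H) : PivotDeleteReachable G H := by
  induction h with
  | refl => exact .refl
  | pivot _ u v huv ih => exact ih.pivot u v huv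

theorem PivotDeleteReachable.isPivotMinor {W U V : Type u} [Finite U] {T : SimpleGraph W}
    {H : SimpleGraph U} {G : SimpleGraph V} (h : PivotDeleteReachable T H) (e : G ↪g H) :
    G.IsPivotMinor T := by
  induction hn : Nat.card U using Nat.strong_induction_on generalizing U with
  | _ n ih =>
    by_cases hs : Function.Surjective e
    · exact ⟨U, H, h, ⟨RelIso.ofSurjective e hs⟩⟩
    · simp only [Function.Surjective, not_forall, not_exists] at hs
      obtain ⟨x, hx⟩ := hs
      refine ih (Nat.card ({x}ᶜ : Set U)) ?_ (h.deleteVertex x)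
        ⟨⟨fun y => ⟨e y, hx y⟩, fun y z hyz => e.injective (congrArg Subtype.val hyz)⟩,
          e.map_adj_iff⟩ rfl
      rw [← hn]
      exact Finite.card_subtype_lt (x := x) (by simp)

theorem Elim.exists_isPivotMinor {G : SimpleGraph V} (hE : G.Elim Set.univ) :
    ∃ (W : Type u) (_ : Fintype W) (T : SimpleGraph W), T.IsTree ∧ G.IsPivotMinor T := by
  obtain ⟨W, _, T, H, φ, hT, hH, hφ, hadj⟩ := hE.exists_tree
  exact ⟨W, inferInstance, T, hT, hH.pivotDeleteReachable.isPivotMinor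
    ⟨⟨φ, Set.injOn_univ.1 hφ⟩, hadj _ trivial _ trivial⟩⟩

/-! ### Rank-decompositions of width at most one -/

theorem ncard_neighborSet_eq_degree {N : Type*} [Fintype N] (T : SimpleGraph N)
    (x : N) [Fintype (T.neighborSet x)] : (T.neighborSet x).ncard = T.degree x := by
  rw [← coe_neighborFinset, Set.ncard_coe_finset, card_neighborFinset_eq_degree]

theorem isLeaf_iff_ncard {N : Type u} [Fintype N] (T : SimpleGraph N) (x : N) :
    T.IsLeaf x ↔ (T.neighborSet x).ncard = 1 := by
  classical
  rw [IsLeaf, ncard_neighborSet_eq_degree]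

theorem RankDecomposition.width_le_one_iff [Fintype V] (D : RankDecomposition V)
    (G : SimpleGraph V) :
    D.width G ≤ 1 ↔ ∀ x y, D.tree.Adj x y → G.CutLeOne Set.univ (D.side x y) := by
  simp only [RankDecomposition.width, iSup_le_iff, ← cutRank_le_one_iff, Nat.cast_le_one]

theorem elim_of_rankWidth_le_one [Fintype V] {G : SimpleGraph V} (hG : G.IsBipartite)
    (h : G.rankWidth ≤ 1) : G.Elim Set.univ := by
  classical
  unfold rankWidth at h
  split_ifs at h with hcard
  · exact Elim.base _ (fun x _ y _ => Fintype.card_le_one_iff.1 hcard x y)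
  -- A strict bound on the infimum produces a decomposition, and also excludes the value `⊤` of an
  -- empty family.
  · obtain ⟨D, hD⟩ : ∃ D : RankDecomposition V, D.width G < 2 :=
      iInf_lt_iff.1 (h.trans_lt (by norm_num))
    have hD : D.width G ≤ 1 := Order.le_of_lt_add_one (by rwa [one_add_one_eq_two])
    rw [D.width_le_one_iff] at hD
    have : Nontrivial D.node := Fintype.one_lt_card_iff_nontrivial.1 D.subcubic.two_le_card
    refine elim_of_decomposition D.subcubic.isTree (L := fun a => (D.L a : D.node)) ?_ hG
      (Subtype.val_injective.comp D.L.injective)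
      (fun a => (isLeaf_iff_ncard _ _).1 (D.L a).2) hD Set.univ
    intro x
    by_cases hx : D.tree.IsLeaf x
    · exact Or.inl ((isLeaf_iff_ncard _ _).1 hx)
    · right
      rw [ncard_neighborSet_eq_degree]
      exact D.subcubic.degree_inner x hx

theorem rankWidth_le_one_of_elim [Fintype V] {U : Type u} {G : SimpleGraph V} {H : SimpleGraph U}
    (e : G ↪g H) (hE : H.Elim (Set.range e)) : G.rankWidth ≤ 1 := by
  classical
  unfold rankWidth
  split_ifs with hcard
  · exact zero_le_one
  · have hV : Nontrivial V := by
      rw [← Fintype.one_lt_card_iff_nontrivial]; omega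
    obtain ⟨N, _, T, L, hT, hdeg, hL, hcut⟩ :=
      hE.exists_decomposition (by rw [← Set.image_univ]; exact Set.nontrivial_univ.image e.injective)
    have hbij : Function.Bijective
        (fun a => ⟨L (e a), (isLeaf_iff_ncard _ _).2 (hL.mapsTo ⟨a, rfl⟩)⟩ :
          V → {x : N // T.IsLeaf x}) := by
      constructor
      · intro a b hab
        exact e.injective (hL.injOn ⟨a, rfl⟩ ⟨b, rfl⟩ (congrArg Subtype.val hab))
      · rintro ⟨x, hx⟩
        obtain ⟨_, ⟨a, rfl⟩, ha⟩ := hL.surjOn ((isLeaf_iff_ncard _ _).1 hx)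
        exact ⟨a, Subtype.ext ha⟩
    have hsub : T.IsSubcubicTree :=
      { isTree := hT
        two_le_card := by
          obtain ⟨a, b, hab⟩ := exists_pair_ne V
          have hne : L (e a) ≠ L (e b) := fun h =>
            hab (e.injective (hL.injOn ⟨a, rfl⟩ ⟨b, rfl⟩ h))
          exact Fintype.one_lt_card_iff.2 ⟨_, _, hne⟩
        degree_inner := fun x hx => by
          rw [← ncard_neighborSet_eq_degree]
          exact (hdeg x).resolve_left fun h => hx ((isLeaf_iff_ncard _ _).2 h) }
    let D : RankDecomposition V :=
      { node := N, tree := T, subcubic := hsub, L := Equiv.ofBijective _ hbij }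
    refine (iInf_le _ D).trans ((D.width_le_one_iff G).2 fun x y hxy => ?_)
    intro a _ ha a' _ ha' b _ hb b' _ hb'
    have := hcut x y hxy ⟨a, rfl⟩ ha ⟨a', rfl⟩ ha' ⟨b, rfl⟩ hb ⟨b', rfl⟩ hb'
    simpa only [e.map_adj_iff] using this

theorem isBipartite_and_rankWidth_le_one_of_isPivotMinor [Fintype V] {W : Type u} [Fintype W]
    {G : SimpleGraph V} {T : SimpleGraph W} (hT : T.IsTree) (h : G.IsPivotMinor T) :
    G.IsBipartite ∧ G.rankWidth ≤ 1 := by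
  obtain ⟨V', G', hG', ⟨i⟩⟩ := h
  obtain ⟨H, hH, ⟨e'⟩⟩ := hG'.exists_embedding
  let e : G ↪g H := e'.comp i.toEmbedding
  have hbip : H.IsBipartite := hH.isBipartite hT.isBipartite
  refine ⟨hbip.of_hom e.toHom, ?_⟩
  refine rankWidth_le_one_of_elim e ?_
  by_cases hsub : (Set.univ : Set W).Subsingleton
  · exact Elim.base _ (hsub.anti (Set.subset_univ _))
  obtain ⟨N, _, T₀, L, hT₀, hdeg, hL, hcut⟩ :=
    (hT.elim Set.finite_univ).exists_decomposition (Set.not_subsingleton_iff.1 hsub)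
  have : Nontrivial N := by
    obtain ⟨a, _, b, _, hab⟩ := Set.not_subsingleton_iff.1 hsub
    exact ⟨L a, L b, fun h => hab (hL.injOn trivial trivial h)⟩
  -- The decomposition of `T` is reused for `H`, and the freedom in the vertex set yields an
  -- ordering of the range of `e` without pruning the decomposition tree.
  exact elim_of_decomposition hT₀ hdeg hbip (Set.injOn_univ.1 hL.injOn)
    (fun a => hL.mapsTo (Set.mem_univ a)) (fun x y hxy => hH.cutLeOne (hcut x y hxy)) _

end SimpleGraph

theorem mainTheorem5 {V : Type u} [Fintype V] (G : SimpleGraph V) :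
    (G.IsBipartite ∧ G.rankWidth ≤ 1) ↔
      ∃ (W : Type u) (_ : Fintype W) (T : SimpleGraph W), T.IsTree ∧ G.IsPivotMinor T := by
  constructor
  · rintro ⟨hG, h⟩
    exact (SimpleGraph.elim_of_rankWidth_le_one hG h).exists_isPivotMinor
  · rintro ⟨W, _, T, hT, h⟩
    exact SimpleGraph.isBipartite_and_rankWidth_le_one_of_isPivotMinor hT h
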